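/- A brick in $\mathbb R^n$ is a set $J=[a_1,b_1]\times\cdots\times[a_n,b_n]$ with $a_j<b_j$ for all $j$; its volume is $\mu(J)=\prod_j(b_j-a_j)$ and its coefficient of regularity is $r(J)=\mu(J)/d^n$, where $d$ is the length of its longest edge. A division of a brick $I$ is a finite set of non-overlapping bricks $J$ with union $I$, together with an associated point $P\in J$ for each of them. For a function $\delta>0$, a brick $J$ with associated point $P\in J$ is $\delta$-compatible if $J$ lies in the open Euclidean ball with centre $P$ and radius $\delta(P)$, and a division is $\delta$-compatible if all its bricks are. For a real- or complex-valued function $h$ of the bricks $J\subseteq I$ and a set $X\subseteq\mathbb R^n$ let $$V(h;I;X)=\inf_{\delta>0}\ \sup_{\mathcal D}\ (\mathcal D)\sum_{P\in X}|h(J)|\in[0,+\infty],$$ where $\mathcal D$ runs through the $\delta$-compatible divisions of $I$ and the sum is over the bricks $J$ of $\mathcal D$ with associated point $P\in X$. We call $h$ finitely additive if $h(J)=(\mathcal D)\sum h$ for every brick $J\subseteq I$ and every division $\mathcal D$ of $J$, and absolutely continuous in $I$ if $$\sup\{V(h;I;X):X\subseteq I,\ V(\mu;I;X)\le\varepsilon\}\to0\quad\text{as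 }\varepsilon\to0+.$$ A number $D$ is the derivative $D(h;\mu;I;P)$ of $h$ at $P\in I$ if for all $\varepsilon>0$ and $\alpha>0$ there is a $\delta>0$ such that $|h(J)/\mu(J)-D|<\varepsilon$ for all bricks $J\subseteq I$ with $P\in J$ and $r(J)\ge\alpha$ that lie in the open ball with centre $P$ and radius $\delta$. **Theorem.** Let $I$ be a brick in $\mathbb R^n$ and let the real- or complex-valued function $h(J)$ of bricks $J\subseteq I$ be finitely additive and absolutely continuous in $I$. Then the derivative $D(h;\mu;I;P)$ exists for almost all $P\in I$, that is, the set $X$ of the points $P\in I$ where it does not exist has $V(\mu;I;X)=0$. Further, let $f$ be any function with $f(P)=D(h;\mu;I;P)$ wherever this derivative exists (with arbitrary finite values elsewhere, for instance $0$). Then for every brick $J\subseteq I$ the function $f$ is gauge (Henstock–Kurzweil) integrable over $J$ with $$\int_J f\,d\mu=h(J),$$ and $|f|$ is gauge integrable over $J$ as well. -/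

import Mathlib

open Set Filter Topology MeasureTheory
open scoped ENNReal

/-! A brick `[a₁, b₁] × ⋯ × [aₙ, bₙ]` with `aⱼ < bⱼ` for all `j` is represented by
`J : BoxIntegral.Box (Fin n)`; its set of points, closed as in the text, is `BoxIntegral.Box.Icc J`.
A division of a brick `I` with associated points is a `BoxIntegral.TaggedPrepartition I` that is a
partition of `I`. (Mathlib's convention of half-open boxes only says that the closed bricks of
the division do not overlap.) -/

/-- The volume `μ(J) = (b₁ - a₁) ⋯ (bₙ - aₙ)` of a brick. -/
def brickVolume {n : ℕ} (J : BoxIntegral.Box (Fin n)) : ℝ :=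
  ∏ j, (J.upper j - J.lower j)

/-- The coefficient of regularity `r(J) = μ(J) / dⁿ`, where `d` is the length of the longest
edge of `J`. -/
noncomputable def brickRegularity {n : ℕ} (J : BoxIntegral.Box (Fin n)) : ℝ :=
  brickVolume J / (⨆ j, (J.upper j - J.lower j)) ^ n

/-- The brick `J` with associated point `P` is compatible with the radius `d`: the point `P` lies in
`J`, and `J` lies in the open Euclidean ball with centre `P` and radius `d`. -/
def BrickCompatible {n : ℕ} (d : ℝ) (P : Fin n → ℝ) (J : BoxIntegral.Box (Fin n)) : Prop :=
  P ∈ BoxIntegral.Box.Icc J ∧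
    ∀ Q ∈ BoxIntegral.Box.Icc J, ∑ j, (Q j - P j) ^ 2 < d ^ 2

/-- `π` is a division of `I`, with associated points, that is compatible with the gauge `δ`. -/
def DivisionCompatible {n : ℕ} {I : BoxIntegral.Box (Fin n)} (δ : (Fin n → ℝ) → ℝ)
    (π : BoxIntegral.TaggedPrepartition I) : Prop :=
  π.IsPartition ∧ ∀ J ∈ π, BrickCompatible (δ (π.tag J)) (π.tag J) J

/-- `V(h; I; X; δ)`: the supremum of `∑ χ(X, P) |h(J)|` over all divisions of `I` that are
compatible with `δ`. -/
noncomputable def gaugeVariation {n : ℕ} {𝕜 : Type*} [RCLike 𝕜]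
    (h : BoxIntegral.Box (Fin n) → 𝕜) (I : BoxIntegral.Box (Fin n)) (X : Set (Fin n → ℝ))
    (δ : (Fin n → ℝ) → ℝ) : ℝ≥0∞ :=
  ⨆ (π : BoxIntegral.TaggedPrepartition I) (_ : DivisionCompatible δ π),
    ∑ J ∈ π.boxes, X.indicator (fun _ => ‖h J‖ₑ) (π.tag J)

/-- The variation `V(h; I; X)` of the brick function `h` over `X` in `I`: the infimum of
`V(h; I; X; δ)` over all `δ > 0`. For `h = brickVolume` it is the outer measure of `X` in `I`. -/
noncomputable def brickVariation {n : ℕ} {𝕜 : Type*} [RCLike 𝕜]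
    (h : BoxIntegral.Box (Fin n) → 𝕜) (I : BoxIntegral.Box (Fin n)) (X : Set (Fin n → ℝ)) :
    ℝ≥0∞ :=
  ⨅ (δ : (Fin n → ℝ) → ℝ) (_ : ∀ P, 0 < δ P), gaugeVariation h I X δ

/-- `H(ε)`: the supremum of `V(h; I; X)` over all `X ⊆ I` with `V(μ; I; X) ≤ ε`. -/
noncomputable def variationModulus {n : ℕ} {𝕜 : Type*} [RCLike 𝕜]
    (h : BoxIntegral.Box (Fin n) → 𝕜) (I : BoxIntegral.Box (Fin n)) (ε : ℝ≥0∞) : ℝ≥0∞ :=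
  ⨆ (X : Set (Fin n → ℝ)) (_ : X ⊆ BoxIntegral.Box.Icc I)
    (_ : brickVariation brickVolume I X ≤ ε), brickVariation h I X

/-- `h` is absolutely continuous in `I`: `H(ε) → 0` as `ε → 0` through positive values. -/
def BrickAbsolutelyContinuous {n : ℕ} {𝕜 : Type*} [RCLike 𝕜]
    (h : BoxIntegral.Box (Fin n) → 𝕜) (I : BoxIntegral.Box (Fin n)) : Prop :=
  Tendsto (variationModulus h I) (𝓝[>] 0) (𝓝 0)

/-- `D` is the derivative `D(h; μ; I; P)` of `h` with respect to `μ` and `I` at `P`. -/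
def HasBrickDerivAt {n : ℕ} {𝕜 : Type*} [RCLike 𝕜]
    (h : BoxIntegral.Box (Fin n) → 𝕜) (I : BoxIntegral.Box (Fin n)) (D : 𝕜)
    (P : Fin n → ℝ) : Prop :=
  ∀ ε > (0 : ℝ), ∀ α > (0 : ℝ), ∃ d > (0 : ℝ), ∀ J ≤ I,
    BrickCompatible d P J → α ≤ brickRegularity J → ‖h J / (brickVolume J : 𝕜) - D‖ < ε

/-! ### Variation of brick functions and the classical `ε`-`η` form of absolute continuity. -/

section Variation

variable {n : ℕ} {𝕜 : Type*} [RCLike 𝕜] {I : BoxIntegral.Box (Fin n)}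

open BoxIntegral

/-! The function `h` turns out to be the indefinite Lebesgue integral of some `g`, and the rest is
Lebesgue differentiation.

Absolute continuity in terms of variations implies the classical condition: `∑ ‖h J‖` is small over
every finite family of non-overlapping bricks of small total volume
(`BrickAbsolutelyContinuous.exists_sum_norm_le`). Only the inequality "volume variation at most
outer measure" is needed for this. A bisection argument then gives bounded variation
(`exists_forall_sum_norm_le`).

For real `h` the step functions `h J / μ(J)` on the dyadic partitions form a martingale, by
additivity, and it is uniformly integrable, by the classical condition. Its limit `g` satisfies `∫_J
g = h J` for dyadic `J`. Exhausting an arbitrary brick by dyadic ones extends this to all `J ≤ I`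
(`setIntegral_eq_of_dyadic`); complex values are treated by real and imaginary parts.

Bricks of regularity bounded below belong to a Vitali family, so the derivative of `h` is `g` almost
everywhere (`ae_hasBrickDerivAt`). Hence `f = g` almost everywhere, and a Lebesgue integrable
function is gauge integrable with the same integral, as is its norm. -/

theorem brickVolume_pos (J : Box (Fin n)) : 0 < brickVolume J :=
  Finset.prod_pos fun j _ => sub_pos.2 (J.lower_lt_upper j)

theorem volume_coe_box (J : Box (Fin n)) :
    volume (J : Set (Fin n → ℝ)) = ENNReal.ofReal (brickVolume J) := by
  rw [Box.coe_eq_pi, Real.volume_pi_Ioc, brickVolume,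
    ENNReal.ofReal_prod_of_nonneg fun j _ => sub_nonneg.2 (J.lower_le_upper j)]

theorem volume_Icc_box (J : Box (Fin n)) :
    volume (Box.Icc J) = ENNReal.ofReal (brickVolume J) := by
  rw [← measure_congr (Box.coe_ae_eq_Icc J), volume_coe_box]

theorem measureReal_coe_box (J : Box (Fin n)) :
    volume.real (J : Set (Fin n → ℝ)) = brickVolume J := by
  rw [measureReal_def, volume_coe_box, ENNReal.toReal_ofReal (brickVolume_pos J).le]

theorem enorm_brickVolume (J : Box (Fin n)) :
    ‖brickVolume J‖ₑ = volume (J : Set (Fin n → ℝ)) := by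
  rw [volume_coe_box, Real.enorm_of_nonneg (brickVolume_pos J).le]

/-- The volume variation over `X` is at most the outer Lebesgue measure of `X`. -/
theorem brickVariation_brickVolume_le (I : Box (Fin n)) (X : Set (Fin n → ℝ)) :
    brickVariation brickVolume I X ≤ volume X := by
  refine le_of_forall_gt fun c hc => ?_
  obtain ⟨U, hXU, hU, hUc⟩ := X.exists_isOpen_lt_of_lt c hc
  have key : ∀ P : Fin n → ℝ, ∃ d > 0, P ∈ U → Metric.ball P d ⊆ U := fun P => by
    by_cases hP : P ∈ U
    · obtain ⟨d, hd, h⟩ := Metric.isOpen_iff.1 hU P hP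
      exact ⟨d, hd, fun _ => h⟩
    · exact ⟨1, one_pos, fun h => absurd h hP⟩
  choose δ hδ hδU using key
  refine lt_of_le_of_lt (iInf₂_le δ hδ) (lt_of_le_of_lt (iSup₂_le fun π hπ => ?_) hUc)
  classical
  have hdisj : (π.boxes : Set (Box (Fin n))).PairwiseDisjoint
      (fun J => (J : Set (Fin n → ℝ))) := π.pairwiseDisjoint
  calc ∑ J ∈ π.boxes, X.indicator (fun _ => ‖brickVolume J‖ₑ) (π.tag J)
      = ∑ J ∈ π.boxes with π.tag J ∈ X, volume (J : Set (Fin n → ℝ)) := by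
        rw [Finset.sum_filter]
        exact Finset.sum_congr rfl fun J _ => by simp [indicator, enorm_brickVolume]
    _ = volume (⋃ J ∈ π.boxes.filter fun J => π.tag J ∈ X, (J : Set (Fin n → ℝ))) := by
        rw [measure_biUnion_finset
            (hdisj.subset (Finset.coe_subset.2 (Finset.filter_subset _ _))) fun J _ =>
              J.measurableSet_coe]
    _ ≤ volume U := by
        refine measure_mono (iUnion₂_subset fun J hJ => ?_)
        obtain ⟨hJπ, hJX⟩ := Finset.mem_filter.1 hJ
        refine fun Q hQ => hδU _ (hXU hJX) ?_
        have hlt := (hπ.2 J hJπ).2 Q (Box.coe_subset_Icc hQ)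
        refine (dist_pi_lt_iff (hδ _)).2 fun j => ?_
        rw [Real.dist_eq]
        refine abs_lt_of_sq_lt_sq (lt_of_le_of_lt ?_ hlt) (hδ _).le
        exact Finset.single_le_sum (f := fun j => (Q j - π.tag J j) ^ 2)
          (fun i _ => sq_nonneg _) (Finset.mem_univ j)

/-- Passes from the sup distance to the Euclidean one. The divisor `n + 1` gives strict inequality
and also covers `n = 0`. -/
theorem sum_sq_lt_sq {d : ℝ} (hd : 0 < d) {P Q : Fin n → ℝ}
    (h : ∀ j, dist (Q j) (P j) ≤ d / (n + 1)) : ∑ j, (Q j - P j) ^ 2 < d ^ 2 := by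
  calc ∑ j, (Q j - P j) ^ 2 ≤ ∑ _j : Fin n, (d / (n + 1)) ^ 2 := by
        refine Finset.sum_le_sum fun j _ => ?_
        rw [← sq_abs, ← Real.dist_eq]
        exact pow_le_pow_left₀ dist_nonneg (h j) 2
    _ = n / (n + 1) ^ 2 * d ^ 2 := by
        rw [Finset.sum_const, Finset.card_univ, Fintype.card_fin, nsmul_eq_mul]
        field_simp
    _ < 1 * d ^ 2 := by
        refine mul_lt_mul_of_pos_right ?_ (pow_pos hd 2)
        rw [div_lt_one (by positivity)]
        nlinarith [(Nat.cast_nonneg n : (0 : ℝ) ≤ n)]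
    _ = d ^ 2 := one_mul _

/-- Complete `π` by its complement to a partition of `I` and subdivide every box finely enough for
`δ` (Cousin's lemma). By additivity `‖h J‖` is at most the sum over the pieces of `J`, and their
tags lie in `Box.Icc J ⊆ X`, so all of them are counted. -/
theorem sum_enorm_le_gaugeVariation (h : BoxAdditiveMap (Fin n) 𝕜 (I : WithTop (Box (Fin n))))
    (π : Prepartition I) {δ : (Fin n → ℝ) → ℝ} (hδ : ∀ P, 0 < δ P) {X : Set (Fin n → ℝ)}
    (hX : ∀ J ∈ π, Box.Icc J ⊆ X) :
    ∑ J ∈ π.boxes, ‖h J‖ₑ ≤ gaugeVariation (fun J => h J) I X δ := by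
  classical
  let r : (Fin n → ℝ) → Ioi (0 : ℝ) := fun P =>
    ⟨δ P / (n + 1), div_pos (hδ P) (by positivity)⟩
  have hex := fun J : Box (Fin n) =>
    J.exists_taggedPartition_isHenstock_isSubordinate_homothetic r
  choose σ hσp hσH hσr _ _ using hex
  have hd : Disjoint π.iUnion π.compl.iUnion := by
    rw [π.iUnion_compl]; exact disjoint_sdiff_right
  let p := π.disjUnion π.compl hd
  have hp : p.IsPartition := Prepartition.isPartitionDisjUnionOfEqDiff π.iUnion_compl
  have hcomp : DivisionCompatible δ (p.biUnionTagged σ) := by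
    refine ⟨hp.biUnionTagged fun J _ => hσp J, fun K hK => ⟨?_, fun Q hQ => ?_⟩⟩
    · exact (TaggedPrepartition.isHenstock_biUnionTagged.2 fun J _ => hσH J) K hK
    · have h1 := (TaggedPrepartition.isSubordinate_biUnionTagged.2 fun J _ => hσr J) K hK hQ
      exact sum_sq_lt_sq (hδ _) fun j => (dist_le_pi_dist Q _ j).trans h1
  refine le_trans ?_ (le_iSup₂ (f := fun (π : TaggedPrepartition I) (_ : DivisionCompatible δ π) =>
    ∑ J ∈ π.boxes, X.indicator (fun _ => ‖h J‖ₑ) (π.tag J)) _ hcomp)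
  have hsub : π.boxes ⊆ p.boxes := Finset.subset_union_left
  calc ∑ J ∈ π.boxes, ‖h J‖ₑ
      ≤ ∑ J ∈ π.boxes, ∑ K ∈ (σ J).boxes,
          X.indicator (fun _ => ‖h K‖ₑ) ((p.biUnionTagged σ).tag K) := by
        refine Finset.sum_le_sum fun J hJ => ?_
        rw [← h.sum_partition_boxes (WithTop.coe_le_coe.2 (π.le_of_mem hJ)) (hσp J)]
        refine (enorm_sum_le _ _).trans (Finset.sum_le_sum fun K hK => ?_)
        rw [Prepartition.tag_biUnionTagged p (hsub hJ) hK,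
          indicator_of_mem (hX J hJ ((σ J).tag_mem_Icc K))]
    _ ≤ ∑ J ∈ p.boxes, ∑ K ∈ (σ J).boxes,
          X.indicator (fun _ => ‖h K‖ₑ) ((p.biUnionTagged σ).tag K) :=
        Finset.sum_le_sum_of_subset hsub
    _ = _ := (Prepartition.sum_biUnion_boxes p (fun J => (σ J).toPrepartition) _).symm

/-- The set `X` to test absolute continuity on is the union of the closed boxes of `π`; its outer
measure is at most their total volume. -/
theorem BrickAbsolutelyContinuous.exists_sum_norm_le
    {h : BoxAdditiveMap (Fin n) 𝕜 (I : WithTop (Box (Fin n)))}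
    (hac : BrickAbsolutelyContinuous (fun J => h J) I) {ε : ℝ} (hε : 0 < ε) :
    ∃ η > 0, ∀ π : Prepartition I, ∑ J ∈ π.boxes, brickVolume J ≤ η →
      ∑ J ∈ π.boxes, ‖h J‖ ≤ ε := by
  -- Requiring `η < 1` only keeps `η` finite, so that `η.toReal` is positive.
  have hev := (hac.eventually (gt_mem_nhds (ENNReal.ofReal_pos.2 hε))).and
    (Ioo_mem_nhdsGT (zero_lt_one (α := ℝ≥0∞)))
  obtain ⟨η, hη, hη0, hη1⟩ := hev.exists
  refine ⟨η.toReal, ENNReal.toReal_pos hη0.ne' (hη1.trans ENNReal.one_lt_top).ne, fun π hπ => ?_⟩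
  let X : Set (Fin n → ℝ) := ⋃ J ∈ π.boxes, Box.Icc J
  have hXI : X ⊆ Box.Icc I := iUnion₂_subset fun J hJ => Box.le_iff_Icc.1 (π.le_of_mem hJ)
  have hXη : brickVariation brickVolume I X ≤ η := by
    refine (brickVariation_brickVolume_le I X).trans ((measure_biUnion_finset_le _ _).trans ?_)
    simp_rw [volume_Icc_box]
    rw [← ENNReal.ofReal_sum_of_nonneg fun J _ => (brickVolume_pos J).le]
    exact ENNReal.ofReal_le_of_le_toReal hπ
  have hlt : brickVariation (fun J => h J) I X < ENNReal.ofReal ε :=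
    lt_of_le_of_lt (le_iSup_of_le X (le_iSup₂_of_le (f := fun (_ : X ⊆ Box.Icc I)
      (_ : brickVariation brickVolume I X ≤ η) =>
        brickVariation (fun J => h J) I X) hXI hXη le_rfl)) hη
  obtain ⟨δ, hδ, hδlt⟩ := by simpa only [brickVariation, iInf_lt_iff] using hlt
  have hle := (sum_enorm_le_gaugeVariation h π hδ (X := X) fun J hJ =>
    subset_biUnion_of_mem (u := fun J : Box (Fin n) => Box.Icc J) hJ).trans hδlt.le
  simp_rw [← ofReal_norm] at hle
  rw [← ENNReal.ofReal_sum_of_nonneg fun J _ => norm_nonneg _] at hle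
  exact (ENNReal.ofReal_le_ofReal_iff hε.le).1 hle

end Variation

/-! ### Bounded variation by bisection. -/

section BoundedVariation

variable {n : ℕ} {𝕜 : Type*} [RCLike 𝕜] {I : BoxIntegral.Box (Fin n)}

open BoxIntegral

/-- Splitting the boxes of `π` along a partition `ρ` of `J`. -/
theorem sum_norm_le_sum_restrict (h : BoxAdditiveMap (Fin n) 𝕜 (I : WithTop (Box (Fin n))))
    {J : Box (Fin n)} (hJ : J ≤ I) (π ρ : Prepartition J) (hρ : ρ.IsPartition) :
    ∑ K ∈ π.boxes, ‖h K‖ ≤ ∑ L ∈ ρ.boxes, ∑ K ∈ (π.restrict L).boxes, ‖h K‖ := by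
  -- The boxes of the common refinement are grouped once by `π` and once by `ρ`.
  have hb : (π ⊓ ρ).boxes = (ρ ⊓ π).boxes := by rw [inf_comm]
  calc ∑ K ∈ π.boxes, ‖h K‖ ≤ ∑ K ∈ π.boxes, ∑ L ∈ (ρ.restrict K).boxes, ‖h L‖ := by
        refine Finset.sum_le_sum fun K hK => ?_
        have hKJ := π.le_of_mem hK
        rw [← h.sum_partition_boxes (WithTop.coe_le_coe.2 (hKJ.trans hJ)) (hρ.restrict hKJ)]
        exact norm_sum_le _ _
    _ = ∑ K ∈ (π ⊓ ρ).boxes, ‖h K‖ := (Prepartition.sum_biUnion_boxes _ _ _).symm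
    _ = _ := by rw [hb]; exact Prepartition.sum_biUnion_boxes _ _ _

/-- A box function satisfying the classical `ε`-`η` condition has bounded variation. -/
theorem exists_forall_sum_norm_le
    (h : BoxAdditiveMap (Fin n) 𝕜 (I : WithTop (Box (Fin n))))
    (hac : ∀ ε > 0, ∃ η > 0, ∀ π : Prepartition I, ∑ J ∈ π.boxes, brickVolume J ≤ η →
      ∑ J ∈ π.boxes, ‖h J‖ ≤ ε) :
    ∃ B, ∀ π : Prepartition I, ∑ J ∈ π.boxes, ‖h J‖ ≤ B := by
  classical
  -- In dimension 0 a point has volume 1, so the local step below would fail; but there is only one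
  -- box.
  rcases Nat.eq_zero_or_pos n with rfl | hn
  · refine ⟨‖h I‖, fun π => ?_⟩
    have hs : π.boxes ⊆ {I} := fun J _ => Finset.mem_singleton.2 <|
      Box.ext fun x => by simp [Box.mem_def]
    exact (Finset.sum_le_sum_of_subset_of_nonneg hs fun _ _ _ => norm_nonneg _).trans_eq
      (Finset.sum_singleton _ _)
  obtain ⟨η, hη, hle⟩ := hac 1 one_pos
  -- Bounds on the `2 ^ n` halves add up to a bound on the whole, and near any point `z` a box lies
  -- in an open set of volume below `η`, where the bound 1 holds.
  have key : I ≤ I → ∃ B, ∀ π : Prepartition I, ∑ J ∈ π.boxes, ‖h J‖ ≤ B := by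
    refine Box.subbox_induction_on (p := fun J => J ≤ I → ∃ B, ∀ π : Prepartition J,
      ∑ K ∈ π.boxes, ‖h K‖ ≤ B) I (fun J hJ hsplit _ => ?_) (fun z _ => ?_)
    · have hs : ∀ L ∈ Prepartition.splitCenter J, ∃ B, ∀ π : Prepartition L,
          ∑ K ∈ π.boxes, ‖h K‖ ≤ B := fun L hL =>
        hsplit L hL ((Prepartition.le_of_mem _ hL).trans hJ)
      choose! B hB using hs
      exact ⟨∑ L ∈ (Prepartition.splitCenter J).boxes, B L, fun π =>
        (sum_norm_le_sum_restrict h hJ π _ (Prepartition.isPartition_splitCenter J)).trans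
          (Finset.sum_le_sum fun L hL => hB L hL _)⟩
    · obtain ⟨U, hzU, hU, hUη⟩ := ({z} : Set (Fin n → ℝ)).exists_isOpen_lt_of_lt
        (μ := volume) (ENNReal.ofReal η) (by
          have : Nonempty (Fin n) := ⟨⟨0, hn⟩⟩
          rw [measure_singleton]; exact ENNReal.ofReal_pos.2 hη)
      refine ⟨U, mem_nhdsWithin_of_mem_nhds (hU.mem_nhds (hzU rfl)), ?_⟩
      intro J hJ _ _ hJU _ _
      refine ⟨1, fun π => ?_⟩
      let ρ : Prepartition I := ⟨π.boxes, fun K hK => (π.le_of_mem hK).trans hJ,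
        π.pairwiseDisjoint⟩
      refine hle ρ ?_
      have hvol : ∑ K ∈ π.boxes, brickVolume K = volume.real π.iUnion := by
        rw [Prepartition.measure_iUnion_toReal]
        exact Finset.sum_congr rfl fun K _ => (measureReal_coe_box K).symm
      refine hvol.trans_le ?_
      rw [measureReal_def]
      exact ENNReal.toReal_le_of_le_ofReal hη.le ((measure_mono
        ((π.iUnion_subset.trans Box.coe_subset_Icc).trans hJU)).trans hUη.le)
  exact key le_rfl

end BoundedVariation

/-! ### Step densities and their uniform integrability. -/

section Density

open BoxIntegral

variable {n : ℕ} {I : Box (Fin n)}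

/-- The step function with the value `h J / μ(J)` on each box `J` of `π`. -/
noncomputable def boxDensity (h : Box (Fin n) → ℝ) (π : Prepartition I) (x : Fin n → ℝ) : ℝ :=
  ∑ J ∈ π.boxes, (J : Set (Fin n → ℝ)).indicator (fun _ => h J / brickVolume J) x

theorem boxDensity_of_mem (h : Box (Fin n) → ℝ) (π : Prepartition I) {J : Box (Fin n)}
    (hJ : J ∈ π) {x : Fin n → ℝ} (hx : x ∈ J) : boxDensity h π x = h J / brickVolume J := by
  rw [boxDensity, Finset.sum_eq_single_of_mem J hJ fun K hK hKJ => ?_,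
    indicator_of_mem ((Box.mem_coe J).2 hx)]
  exact indicator_of_notMem (fun hxK => hKJ (π.eq_of_mem_of_mem hK hJ hxK hx)) _

theorem boxDensity_of_notMem (h : Box (Fin n) → ℝ) (π : Prepartition I) {x : Fin n → ℝ}
    (hx : x ∉ π.iUnion) : boxDensity h π x = 0 :=
  Finset.sum_eq_zero fun J hJ =>
    indicator_of_notMem (fun hxJ => hx (π.mem_iUnion.2 ⟨J, hJ, hxJ⟩)) _

theorem integrable_indicator_box (ν : Measure (Fin n → ℝ)) [IsFiniteMeasure ν] (J : Box (Fin n))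
    (c : ℝ) : MeasureTheory.Integrable ((J : Set (Fin n → ℝ)).indicator fun _ => c) ν :=
  (MeasureTheory.integrable_const c).indicator J.measurableSet_coe

theorem integrable_boxDensity (ν : Measure (Fin n → ℝ)) [IsFiniteMeasure ν]
    (h : Box (Fin n) → ℝ) (π : Prepartition I) :
    MeasureTheory.Integrable (boxDensity h π) ν :=
  integrable_finsetSum _ fun J _ => integrable_indicator_box ν J _

theorem setIntegral_boxDensity (ν : Measure (Fin n → ℝ)) [IsFiniteMeasure ν]
    (h : Box (Fin n) → ℝ) (π : Prepartition I) (s : Set (Fin n → ℝ)) :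
    ∫ x in s, boxDensity h π x ∂ν = ∑ J ∈ π.boxes, ν.real (J ∩ s) * (h J / brickVolume J) := by
  simp only [boxDensity]
  rw [integral_finsetSum _ fun J _ => integrable_indicator_box _ J _]
  refine Finset.sum_congr rfl fun J _ => ?_
  rw [integral_indicator J.measurableSet_coe, MeasureTheory.integral_const, smul_eq_mul,
    measureReal_restrict_apply_univ, measureReal_restrict_apply J.measurableSet_coe]

instance isFiniteMeasure_restrict_box (I : Box (Fin n)) :
    IsFiniteMeasure (volume.restrict (I : Set (Fin n → ℝ))) :=
  ⟨by rw [Measure.restrict_apply_univ, volume_coe_box]; exact ENNReal.ofReal_lt_top⟩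

theorem measureReal_restrict_box {J : Box (Fin n)} (hJ : J ≤ I) :
    (volume.restrict (I : Set (Fin n → ℝ))).real J = brickVolume J := by
  rw [measureReal_restrict_apply J.measurableSet_coe, inter_eq_left.2 (Box.coe_subset_coe.2 hJ),
    measureReal_coe_box]

theorem setIntegral_boxDensity_of_mem (h : Box (Fin n) → ℝ) (π : Prepartition I) {J : Box (Fin n)}
    (hJ : J ∈ π) :
    ∫ x in (J : Set (Fin n → ℝ)), boxDensity h π x ∂volume.restrict (I : Set (Fin n → ℝ)) =
      h J := by
  rw [setIntegral_boxDensity, Finset.sum_eq_single_of_mem J hJ fun K hK hKJ => ?_, inter_self,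
    measureReal_restrict_box (π.le_of_mem hJ), mul_div_cancel₀ _ (brickVolume_pos J).ne']
  rw [(π.disjoint_coe_of_mem hK hJ hKJ).inter_eq, measureReal_empty, zero_mul]

/-- Refining the partition does not change the integral over a coarse box: this is the martingale
property on generators. -/
theorem setIntegral_boxDensity_biUnion
    (h : BoxAdditiveMap (Fin n) ℝ (I : WithTop (Box (Fin n)))) (π : Prepartition I)
    (σ : ∀ J : Box (Fin n), Prepartition J) (hσ : ∀ J, (σ J).IsPartition) {J : Box (Fin n)}
    (hJ : J ∈ π) :
    ∫ x in (J : Set (Fin n → ℝ)), boxDensity h (π.biUnion σ) x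
      ∂volume.restrict (I : Set (Fin n → ℝ)) = h J := by
  classical
  rw [setIntegral_boxDensity]
  refine (Prepartition.sum_biUnion_boxes π σ _).trans ?_
  rw [Finset.sum_eq_single_of_mem J hJ fun L hL hLJ => Finset.sum_eq_zero fun K hK => ?_,
    ← h.sum_partition_boxes (WithTop.coe_le_coe.2 (π.le_of_mem hJ)) (hσ J)]
  · refine Finset.sum_congr rfl fun K hK => ?_
    have hKJ := (σ J).le_of_mem hK
    rw [inter_eq_left.2 (Box.coe_subset_coe.2 hKJ),
      measureReal_restrict_box (hKJ.trans (π.le_of_mem hJ)),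
      mul_div_cancel₀ _ (brickVolume_pos K).ne']
  · rw [((π.disjoint_coe_of_mem hL hJ hLJ).mono_left
      (Box.coe_subset_coe.2 ((σ L).le_of_mem hK))).inter_eq, measureReal_empty, zero_mul]

theorem eLpNorm_boxDensity_le (h : Box (Fin n) → ℝ) (π : Prepartition I) :
    eLpNorm (boxDensity h π) 1 (volume.restrict (I : Set (Fin n → ℝ))) ≤
      ENNReal.ofReal (∑ J ∈ π.boxes, ‖h J‖) := by
  have hsum : boxDensity h π = ∑ J ∈ π.boxes,
      (J : Set (Fin n → ℝ)).indicator fun _ => h J / brickVolume J := by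
    ext x; simp [boxDensity]
  rw [hsum, ENNReal.ofReal_sum_of_nonneg fun J _ => norm_nonneg _]
  refine (eLpNorm_sum_le (fun J _ => (integrable_indicator_box _ J _).aestronglyMeasurable)
    le_rfl).trans (Finset.sum_le_sum fun J hJ => ?_)
  refine (eLpNorm_mono_measure _ Measure.restrict_le_self).trans ?_
  rw [eLpNorm_indicator_const J.measurableSet_coe one_ne_zero ENNReal.one_ne_top,
    volume_coe_box, ENNReal.toReal_one, div_one, ENNReal.rpow_one, ← ofReal_norm,
    ← ENNReal.ofReal_mul (norm_nonneg _), norm_div, Real.norm_of_nonneg (brickVolume_pos J).le,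
    div_mul_cancel₀ _ (brickVolume_pos J).ne']

/-- Chebyshev's inequality for the step density. -/
theorem sum_brickVolume_le (π : Prepartition I) {C : ℝ} (hC : 0 < C) (h : Box (Fin n) → ℝ)
    (hle : ∀ J ∈ π, C ≤ ‖h J / brickVolume J‖) :
    ∑ J ∈ π.boxes, brickVolume J ≤ (∑ J ∈ π.boxes, ‖h J‖) / C := by
  rw [Finset.sum_div]
  refine Finset.sum_le_sum fun J hJ => ?_
  have := hle J hJ
  rw [norm_div, Real.norm_of_nonneg (brickVolume_pos J).le, le_div_iff₀ (brickVolume_pos J)] at this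
  rw [le_div_iff₀ hC]
  linarith

/-- The density cut off to where its modulus is at least `C` is again a step density, that of a
subfamily of boxes. By Chebyshev their total volume is at most `B / C`, so for large `C` the `ε`-`η`
condition bounds its `L¹` norm by `ε`. -/
theorem uniformIntegrable_boxDensity {α : Type*} (h : Box (Fin n) → ℝ) {B : ℝ}
    (hB : ∀ π : Prepartition I, ∑ J ∈ π.boxes, ‖h J‖ ≤ B)
    (hac : ∀ ε > 0, ∃ η > 0, ∀ π : Prepartition I, ∑ J ∈ π.boxes, brickVolume J ≤ η →
      ∑ J ∈ π.boxes, ‖h J‖ ≤ ε) (π : α → Prepartition I) :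
    UniformIntegrable (fun k => boxDensity h (π k)) 1
      (volume.restrict (I : Set (Fin n → ℝ))) := by
  classical
  refine uniformIntegrable_of le_rfl ENNReal.one_ne_top
    (fun k => (integrable_boxDensity _ h _).aestronglyMeasurable) fun ε hε => ?_
  obtain ⟨η, hη, hle⟩ := hac ε hε
  -- Chosen so that `B / C ≤ η`; the summand 1 makes `C` positive.
  have hC : 0 < (|B| + 1) / η := by positivity
  obtain ⟨C, hCeq⟩ : ∃ C : NNReal, (C : ℝ) = (|B| + 1) / η := ⟨⟨_, hC.le⟩, rfl⟩
  rw [← hCeq] at hC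
  refine ⟨C, fun k => ?_⟩
  let ρ := (π k).filter fun J => C ≤ ‖h J / brickVolume J‖
  have hρ : {x | C ≤ ‖boxDensity h (π k) x‖₊}.indicator
      (boxDensity h (π k)) = boxDensity h ρ := by
    ext x
    have hset : x ∈ {x | C ≤ ‖boxDensity h (π k) x‖₊} ↔
      C ≤ ‖boxDensity h (π k) x‖ := Iff.rfl
    by_cases hx : x ∈ (π k).iUnion
    · obtain ⟨J, hJ, hxJ⟩ := (π k).mem_iUnion.1 hx
      rw [boxDensity_of_mem h _ hJ hxJ] at hset
      by_cases hJC : C ≤ ‖h J / brickVolume J‖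
      · rw [indicator_of_mem (hset.2 hJC), boxDensity_of_mem h _ hJ hxJ,
          boxDensity_of_mem h ρ ((π k).mem_filter.2 ⟨hJ, hJC⟩) hxJ]
      · rw [indicator_of_notMem (mt hset.1 hJC), boxDensity_of_notMem]
        intro hx'
        obtain ⟨K, hK, hxK⟩ := ρ.mem_iUnion.1 hx'
        obtain ⟨hKπ, hKC⟩ := (π k).mem_filter.1 hK
        exact hJC ((π k).eq_of_mem_of_mem hKπ hJ hxK hxJ ▸ hKC)
    · have h0 := boxDensity_of_notMem h _ hx
      rw [boxDensity_of_notMem h ρ fun hx' => hx (Prepartition.iUnion_mono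
        ((π k).filter_le _) hx')]
      simp [indicator, h0]
  rw [hρ]
  refine (eLpNorm_boxDensity_le h ρ).trans (ENNReal.ofReal_le_ofReal (hle ρ ?_))
  refine (sum_brickVolume_le ρ hC h fun J hJ => ((π k).mem_filter.1 hJ).2).trans ?_
  rw [div_le_iff₀ hC, hCeq, mul_div_cancel₀ _ hη.ne']
  exact (hB ρ).trans ((le_abs_self B).trans (by linarith))

end Density

/-! ### The dyadic martingale and its limit. -/

section Dyadic

open BoxIntegral

variable {n : ℕ} {I : Box (Fin n)}

/-- The partition of `I` into `2 ^ (n * k)` congruent boxes. -/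
noncomputable def dyadicPartition (I : Box (Fin n)) : ℕ → Prepartition I
  | 0 => ⊤
  | k + 1 => (dyadicPartition I k).biUnion Prepartition.splitCenter

theorem isPartition_dyadicPartition (I : Box (Fin n)) (k : ℕ) :
    (dyadicPartition I k).IsPartition := by
  induction k with
  | zero => exact Prepartition.isPartitionTop I
  | succ k ih => exact ih.biUnion fun J _ => Prepartition.isPartition_splitCenter J

theorem upper_sub_lower_of_mem_dyadicPartition {k : ℕ} {J : Box (Fin n)}
    (hJ : J ∈ dyadicPartition I k) (i : Fin n) :
    J.upper i - J.lower i = (I.upper i - I.lower i) / 2 ^ k := by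
  induction k generalizing J with
  | zero => rw [Prepartition.mem_top.1 hJ, pow_zero, div_one]
  | succ k ih =>
    obtain ⟨L, hL, hJL⟩ := (Prepartition.mem_biUnion _).1 hJ
    rw [Prepartition.upper_sub_lower_of_mem_splitCenter hJL, ih hL, div_div, pow_succ]

/-- The σ-algebras generated by the boxes of the dyadic partitions. -/
def dyadicFiltration (I : Box (Fin n)) :
    Filtration ℕ (inferInstance : MeasurableSpace (Fin n → ℝ)) where
  seq k := MeasurableSpace.generateFrom
    ((fun J : Box (Fin n) => (J : Set (Fin n → ℝ))) '' (dyadicPartition I k).boxes)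
  mono' := monotone_nat_of_le_succ fun k => by
    refine MeasurableSpace.generateFrom_le ?_
    rintro _ ⟨J, hJ, rfl⟩
    beta_reduce
    rw [← (Prepartition.isPartition_splitCenter J).iUnion_eq, Prepartition.iUnion_def']
    refine @Finset.measurableSet_biUnion _ _ (MeasurableSpace.generateFrom _) _ _ fun K hK =>
      MeasurableSpace.measurableSet_generateFrom ⟨K, ?_, rfl⟩
    exact (Prepartition.mem_biUnion _).2 ⟨J, hJ, hK⟩
  le' k := by
    refine MeasurableSpace.generateFrom_le ?_
    rintro _ ⟨J, -, rfl⟩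
    exact J.measurableSet_coe

theorem measurableSet_dyadicFiltration {k : ℕ} {J : Box (Fin n)}
    (hJ : J ∈ dyadicPartition I k) :
    MeasurableSet[dyadicFiltration I k] (J : Set (Fin n → ℝ)) :=
  MeasurableSpace.measurableSet_generateFrom ⟨J, hJ, rfl⟩

theorem martingale_boxDensity (h : BoxAdditiveMap (Fin n) ℝ (I : WithTop (Box (Fin n)))) :
    Martingale (fun k => boxDensity h (dyadicPartition I k)) (dyadicFiltration I)
      (volume.restrict (I : Set (Fin n → ℝ))) := by
  have hint := fun k => integrable_boxDensity (volume.restrict (I : Set (Fin n → ℝ))) h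
    (dyadicPartition I k)
  -- Equal total integrals at all levels are what the complement case of the π-λ induction needs.
  have htot : ∀ k, ∫ x, boxDensity h (dyadicPartition I k) x
      ∂volume.restrict (I : Set (Fin n → ℝ)) = h I := fun k => by
    rw [← setIntegral_univ, setIntegral_boxDensity,
      ← h.sum_partition_boxes le_rfl (isPartition_dyadicPartition I k)]
    refine Finset.sum_congr rfl fun J hJ => ?_
    rw [inter_univ, measureReal_restrict_box (Prepartition.le_of_mem _ hJ),
      mul_div_cancel₀ _ (brickVolume_pos J).ne']
  refine martingale_of_setIntegral_eq_succ (fun k => ?_) hint fun k s hs => ?_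
  · refine Finset.stronglyMeasurable_fun_sum _ fun J hJ => ?_
    exact stronglyMeasurable_const.indicator (measurableSet_dyadicFiltration hJ)
  · have hle := (dyadicFiltration I).le k
    induction s, hs using MeasurableSpace.induction_on_inter rfl with
    | empty => simp
    | basic t ht =>
      obtain ⟨J, hJ, rfl⟩ := ht
      rw [setIntegral_boxDensity_of_mem h _ hJ]
      exact (setIntegral_boxDensity_biUnion h _ _ Prepartition.isPartition_splitCenter hJ).symm
    | compl t ht ih =>
      rw [setIntegral_compl (hle _ ht) (hint k), setIntegral_compl (hle _ ht) (hint (k + 1)),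
        htot, htot, ih]
    | iUnion f hd hf ih =>
      rw [integral_iUnion (fun i => hle _ (hf i)) hd (hint k).integrableOn,
        integral_iUnion (fun i => hle _ (hf i)) hd (hint (k + 1)).integrableOn]
      exact tsum_congr ih
    -- The boxes of one level form a π-system: two that meet are equal.
    | _ =>
      rintro _ ⟨J, hJ, rfl⟩ _ ⟨K, hK, rfl⟩ ⟨x, hxJ, hxK⟩
      rw [Prepartition.eq_of_mem_of_mem _ hJ hK hxJ hxK, inter_self]
      exact ⟨K, hK, rfl⟩

/-- A uniformly integrable martingale is the sequence of conditional expectations of its limit `g`,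
so `g` has the same integrals over the boxes of each level. -/
theorem exists_integral_dyadic_eq (h : BoxAdditiveMap (Fin n) ℝ (I : WithTop (Box (Fin n))))
    (hac : ∀ ε > 0, ∃ η > 0, ∀ π : Prepartition I, ∑ J ∈ π.boxes, brickVolume J ≤ η →
      ∑ J ∈ π.boxes, ‖h J‖ ≤ ε) :
    ∃ g : (Fin n → ℝ) → ℝ, IntegrableOn g (I : Set (Fin n → ℝ)) ∧
      ∀ k, ∀ J ∈ dyadicPartition I k, ∫ x in (J : Set (Fin n → ℝ)), g x = h J := by
  obtain ⟨B, hB⟩ := exists_forall_sum_norm_le h hac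
  have hM := martingale_boxDensity h
  have hUI := uniformIntegrable_boxDensity h hB hac (dyadicPartition I)
  set ν := volume.restrict (I : Set (Fin n → ℝ)) with hν
  obtain ⟨R, hR⟩ := hUI.2.2
  obtain ⟨g, hg, hgk⟩ : ∃ g : (Fin n → ℝ) → ℝ, MeasureTheory.Integrable g ν ∧
      ∀ k, boxDensity h (dyadicPartition I k) =ᵐ[ν] ν[g | dyadicFiltration I k] :=
    ⟨_, (Filtration.memLp_limitProcess_of_eLpNorm_bdd hUI.1 hR).integrable le_rfl,
      fun k => hM.ae_eq_condExp_limitProcess hUI k⟩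
  refine ⟨g, hg, fun k J hJ => ?_⟩
  have h1 := setIntegral_condExp ((dyadicFiltration I).le k) hg (measurableSet_dyadicFiltration hJ)
  rw [← setIntegral_boxDensity_of_mem h _ hJ,
    integral_congr_ae (ae_restrict_of_ae (hgk k)), h1, hν,
    Measure.restrict_restrict J.measurableSet_coe,
    inter_eq_left.2 (Box.coe_subset_coe.2 (Prepartition.le_of_mem _ hJ))]

end Dyadic

/-! ### Representation of `h` as an indefinite integral on all bricks. -/

section Representation

open BoxIntegral

variable {n : ℕ} {𝕜 : Type*} [RCLike 𝕜] {I : Box (Fin n)}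

theorem isOpen_box_Ioo (J : Box (Fin n)) : IsOpen (Box.Ioo J) :=
  isOpen_set_pi finite_univ fun _ _ => isOpen_Ioo

/-- Eventually the dyadic box around an interior point of `J` lies in `J`. -/
theorem eventually_dyadic_le {J : Box (Fin n)} {x : Fin n → ℝ} (hx : x ∈ Box.Ioo J) :
    ∀ᶠ k in atTop, ∀ K ∈ dyadicPartition I k, x ∈ K → K ≤ J := by
  obtain ⟨d, hd, hdJ⟩ := Metric.isOpen_iff.1 (isOpen_box_Ioo J) x hx
  have hlim : Tendsto (fun k : ℕ => dist I.upper I.lower / 2 ^ k) atTop (𝓝 0) :=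
    tendsto_const_nhds.div_atTop (tendsto_pow_atTop_atTop_of_one_lt one_lt_two)
  filter_upwards [hlim.eventually (gt_mem_nhds hd)] with k hk K hK hxK
  refine Box.coe_subset_coe.1 fun y hy => Box.Ioo_subset_coe J (hdJ ?_)
  refine Metric.mem_ball.2 (lt_of_le_of_lt ((dist_pi_le_iff (by positivity)).2 fun i => ?_) hk)
  have hyi := (Box.mem_def K).1 hy i
  have hxi := (Box.mem_def K).1 hxK i
  have h1 := upper_sub_lower_of_mem_dyadicPartition hK i
  have h2 : I.upper i - I.lower i ≤ dist I.upper I.lower :=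
    (le_abs_self _).trans ((Real.dist_eq _ _).symm.trans_le (dist_le_pi_dist I.upper I.lower i))
  calc dist (y i) (x i) ≤ K.upper i - K.lower i := by
        rw [Real.dist_eq, abs_le]; constructor <;> linarith [hyi.1, hyi.2, hxi.1, hxi.2]
    _ ≤ _ := by rw [h1]; gcongr

/-- Cut `J` along the dyadic partition: `S k` collects the pieces that are whole dyadic boxes, `R k`
the others, which are cut by the boundary of `J`. On `S k` both sides agree. The volume of `R k`
tends to 0, hence so do both contributions of `R k`, by absolute continuity of `h` and of the
integral. -/
theorem setIntegral_eq_of_dyadic (h : BoxAdditiveMap (Fin n) ℝ (I : WithTop (Box (Fin n))))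
    (hac : ∀ ε > 0, ∃ η > 0, ∀ π : Prepartition I, ∑ J ∈ π.boxes, brickVolume J ≤ η →
      ∑ J ∈ π.boxes, ‖h J‖ ≤ ε) {g : (Fin n → ℝ) → ℝ}
    (hg : IntegrableOn g (I : Set (Fin n → ℝ)))
    (hgd : ∀ k, ∀ J ∈ dyadicPartition I k, ∫ x in (J : Set (Fin n → ℝ)), g x = h J)
    {J : Box (Fin n)} (hJ : J ≤ I) : ∫ x in (J : Set (Fin n → ℝ)), g x = h J := by
  classical
  let ρ : ℕ → Prepartition J := fun k => (dyadicPartition I k).restrict J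
  let S : ℕ → Prepartition J := fun k => (ρ k).filter fun K => K ∈ dyadicPartition I k
  let R : ℕ → Prepartition J := fun k => (ρ k).filter fun K => ¬ K ∈ dyadicPartition I k
  have hρ : ∀ k, (ρ k).IsPartition := fun k => (isPartition_dyadicPartition I k).restrict hJ
  have hRS : ∀ k, (R k).iUnion = (J : Set (Fin n → ℝ)) \ (S k).iUnion := fun k => by
    rw [← (hρ k).iUnion_eq]; exact Prepartition.iUnion_filter_not _ _
  have hSm : ∀ k, MeasurableSet (S k).iUnion := fun k =>
    Finset.measurableSet_biUnion _ fun K _ => K.measurableSet_coe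
  have hgJ : IntegrableOn g (J : Set (Fin n → ℝ)) := hg.mono_set (Box.coe_subset_coe.2 hJ)
  have hsplit : ∀ k, h J - ∫ x in (J : Set (Fin n → ℝ)), g x =
      ∑ K ∈ (R k).boxes, h K - ∫ x in (R k).iUnion, g x := fun k => by
    have h1 : h J = ∑ K ∈ (S k).boxes, h K + ∑ K ∈ (R k).boxes, h K := by
      rw [← h.sum_partition_boxes (WithTop.coe_le_coe.2 hJ) (hρ k)]
      convert (Finset.sum_filter_add_sum_filter_not (ρ k).boxes
        (fun K => K ∈ dyadicPartition I k) h).symm using 3 <;>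
      · ext K
        rw [Finset.mem_filter]
        exact (ρ k).mem_filter
    have h2 : ∫ x in (J : Set (Fin n → ℝ)), g x =
        (∫ x in (S k).iUnion, g x) + ∫ x in (R k).iUnion, g x := by
      rw [hRS, setIntegral_sdiff (hSm k) hgJ (S k).iUnion_subset, add_sub_cancel]
    have h3 : ∫ x in (S k).iUnion, g x = ∑ K ∈ (S k).boxes, h K := by
      rw [Prepartition.iUnion_def', integral_biUnion_finset _ (fun K _ => K.measurableSet_coe)
        (S k).pairwiseDisjoint fun K hK =>
          hgJ.mono_set (Box.coe_subset_coe.2 ((S k).le_of_mem hK))]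
      exact Finset.sum_congr rfl fun K hK => hgd k K ((ρ k).mem_filter.1 hK).2
    rw [h2, h3]; linarith
  -- Every interior point of `J` eventually leaves `R k`, and the boundary of `J` is null.
  have hvol : Tendsto (fun k => volume (R k).iUnion) atTop (𝓝 0) := by
    rw [← measure_empty (μ := (volume : Measure (Fin n → ℝ)))]
    refine tendsto_measure_of_ae_tendsto_indicator atTop MeasurableSet.empty
      (fun k => by rw [hRS]; exact J.measurableSet_coe.diff (hSm k)) J.measurableSet_coe
      (by rw [volume_coe_box]; exact ENNReal.ofReal_ne_top)
      (Eventually.of_forall fun k => (R k).iUnion_subset) ?_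
    have hae : Box.Ioo J =ᵐ[volume] (J : Set (Fin n → ℝ)) :=
      (Box.Ioo_ae_eq_Icc J).trans (Box.coe_ae_eq_Icc J).symm
    filter_upwards [hae.mem_iff] with x hx
    by_cases hxJ : x ∈ (J : Set (Fin n → ℝ))
    · filter_upwards [eventually_dyadic_le (I := I) (hx.2 hxJ)] with k hk
      simp only [mem_empty_iff_false, iff_false, hRS]
      obtain ⟨K, hK, hxK⟩ := (isPartition_dyadicPartition I k) x (hJ hxJ)
      have hKJ := hk K hK hxK
      refine fun hn => hn.2 ((S k).mem_iUnion.2 ⟨K, (ρ k).mem_filter.2 ⟨?_, hK⟩, hxK⟩)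
      exact ((dyadicPartition I k).mem_restrict').2
        ⟨K, hK, (inter_eq_right.2 (Box.coe_subset_coe.2 hKJ)).symm⟩
    · refine Eventually.of_forall fun k => ?_
      simp only [mem_empty_iff_false, iff_false]
      exact fun h' => hxJ ((R k).iUnion_subset h')
  have hint : Tendsto (fun k => ∫ x in (R k).iUnion, g x) atTop (𝓝 0) := by
    have h1 := hgJ.tendsto_setIntegral_nhds_zero (l := atTop) (s := fun k => (R k).iUnion)
      (tendsto_of_tendsto_of_tendsto_of_le_of_le tendsto_const_nhds hvol (fun _ => zero_le)
        fun k => Measure.restrict_apply_le _ _)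
    refine h1.congr fun k => ?_
    rw [Measure.restrict_restrict, inter_eq_left.2 (R k).iUnion_subset]
    rw [hRS]; exact J.measurableSet_coe.diff (hSm k)
  have hsum : Tendsto (fun k => ∑ K ∈ (R k).boxes, h K) atTop (𝓝 0) := by
    rw [Metric.tendsto_nhds]
    intro ε hε
    obtain ⟨η, hη, hle⟩ := hac (ε / 2) (half_pos hε)
    filter_upwards [hvol.eventually (gt_mem_nhds (ENNReal.ofReal_pos.2 hη))] with k hk
    let σ : Prepartition I := ⟨(R k).boxes, fun K hK => ((R k).le_of_mem hK).trans hJ,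
      (R k).pairwiseDisjoint⟩
    rw [dist_zero_right]
    refine lt_of_le_of_lt ((norm_sum_le _ _).trans (hle σ ?_)) (half_lt_self hε)
    have hv : ∑ K ∈ (R k).boxes, brickVolume K = volume.real (R k).iUnion := by
      rw [Prepartition.measure_iUnion_toReal]
      exact Finset.sum_congr rfl fun K _ => (measureReal_coe_box K).symm
    refine hv.trans_le ?_
    rw [measureReal_def]
    exact ENNReal.toReal_le_of_le_ofReal hη.le hk.le
  have hlim := (hsum.sub hint).congr fun k => (hsplit k).symm
  rw [sub_zero] at hlim
  linarith [tendsto_nhds_unique hlim tendsto_const_nhds]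

/-- An absolutely continuous additive box function is an indefinite Lebesgue integral. -/
theorem BrickAbsolutelyContinuous.exists_setIntegral_eq
    {h : BoxAdditiveMap (Fin n) 𝕜 (I : WithTop (Box (Fin n)))}
    (hac : BrickAbsolutelyContinuous (fun J => h J) I) :
    ∃ g : (Fin n → ℝ) → 𝕜, IntegrableOn g (I : Set (Fin n → ℝ)) ∧
      ∀ J ≤ I, ∫ x in (J : Set (Fin n → ℝ)), g x = h J := by
  have key : ∀ φ : 𝕜 →+ ℝ, (∀ z, ‖φ z‖ ≤ ‖z‖) → ∃ g : (Fin n → ℝ) → ℝ,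
      IntegrableOn g (I : Set (Fin n → ℝ)) ∧
        ∀ J ≤ I, ∫ x in (J : Set (Fin n → ℝ)), g x = φ (h J) := fun φ hφ => by
    have hac' : ∀ ε > 0, ∃ η > 0, ∀ π : Prepartition I, ∑ J ∈ π.boxes, brickVolume J ≤ η →
        ∑ J ∈ π.boxes, ‖h.map φ J‖ ≤ ε := fun ε hε => by
      obtain ⟨η, hη, hle⟩ := hac.exists_sum_norm_le hε
      exact ⟨η, hη, fun π hπ => (Finset.sum_le_sum fun J _ => hφ (h J)).trans (hle π hπ)⟩
    obtain ⟨g, hg, hgd⟩ := exists_integral_dyadic_eq _ hac'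
    exact ⟨g, hg, fun J hJ => setIntegral_eq_of_dyadic _ hac' hg hgd hJ⟩
  obtain ⟨a, ha, haJ⟩ := key RCLike.re RCLike.norm_re_le_norm
  obtain ⟨b, hb, hbJ⟩ := key RCLike.im RCLike.norm_im_le_norm
  refine ⟨fun x => (a x : 𝕜) + (b x : 𝕜) * RCLike.I, ha.ofReal.add (hb.ofReal.mul_const _),
    fun J hJ => ?_⟩
  have haJ' := ha.mono_set (Box.coe_subset_coe.2 hJ)
  have hbJ' := hb.mono_set (Box.coe_subset_coe.2 hJ)
  rw [integral_add haJ'.ofReal (hbJ'.ofReal.mul_const _), integral_mul_const, integral_ofReal,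
    integral_ofReal, haJ J hJ, hbJ J hJ]
  exact RCLike.re_add_im _

end Representation

/-! ### Differentiation along regular bricks. -/

section Derivative

open BoxIntegral

variable {n : ℕ} {𝕜 : Type*} [RCLike 𝕜] {I : Box (Fin n)}

theorem iSup_edge_nonneg (J : Box (Fin n)) : 0 ≤ ⨆ j, (J.upper j - J.lower j) :=
  Real.iSup_nonneg fun j => sub_nonneg.2 (J.lower_le_upper j)

theorem Icc_subset_closedBall_iSup_edge {J : Box (Fin n)} {P : Fin n → ℝ} (hP : P ∈ Box.Icc J) :
    Box.Icc J ⊆ Metric.closedBall P (⨆ j, (J.upper j - J.lower j)) := by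
  intro Q hQ
  refine (dist_pi_le_iff (iSup_edge_nonneg J)).2 fun j => ?_
  refine le_trans ?_ (le_ciSup (f := fun j => J.upper j - J.lower j)
    (Set.finite_range _).bddAbove j)
  rw [Real.dist_eq, abs_le]
  constructor <;> linarith [hP.1 j, hP.2 j, hQ.1 j, hQ.2 j]

theorem BrickCompatible.Icc_subset_closedBall {d : ℝ} (hd : 0 < d) {P : Fin n → ℝ}
    {J : Box (Fin n)} (h : BrickCompatible d P J) : Box.Icc J ⊆ Metric.closedBall P d := by
  intro Q hQ
  refine (dist_pi_le_iff hd.le).2 fun j => ?_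
  rw [Real.dist_eq]
  refine abs_le_of_sq_le_sq (le_trans ?_ (h.2 Q hQ).le) hd.le
  exact Finset.single_le_sum (f := fun j => (Q j - P j) ^ 2) (fun i _ => sq_nonneg _)
    (Finset.mem_univ j)

/-- Small cubes exist at every point of `I`, so the condition defining the derivative is never
vacuous; its uniqueness rests on this. -/
theorem exists_regular_box {P : Fin n → ℝ} (hP : P ∈ Box.Icc I) {d : ℝ} (hd : 0 < d) :
    ∃ J ≤ I, BrickCompatible d P J ∧ 1 ≤ brickRegularity J := by
  have hev : ∀ᶠ s in 𝓝[>] (0 : ℝ), 0 < s ∧ s < d / (n + 1) ∧ ∀ j, s < I.upper j - I.lower j :=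
    eventually_mem_nhdsWithin.and <|
      (eventually_nhdsWithin_of_eventually_nhds (gt_mem_nhds (by positivity))).and <|
        eventually_all.2 fun j => eventually_nhdsWithin_of_eventually_nhds
          (gt_mem_nhds (sub_pos.2 (I.lower_lt_upper j)))
  obtain ⟨s, hs, hsd, hsI⟩ := hev.exists
  -- A cube of side `s` with lower corner `P`, pushed back into `I` near the upper faces.
  let J : Box (Fin n) := ⟨fun j => min (P j) (I.upper j - s),
    fun j => min (P j) (I.upper j - s) + s, fun j => by linarith⟩
  have hedge : ∀ j, J.upper j - J.lower j = s := fun j => by simp [J]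
  have hPJ : P ∈ Box.Icc J := by
    refine ⟨fun j => min_le_left _ _, fun j => ?_⟩
    change P j ≤ min (P j) (I.upper j - s) + s
    rw [← min_add_add_right]
    exact le_min (by linarith) (by linarith [hP.2 j])
  refine ⟨J, Box.le_iff_bounds.2 ⟨fun j => le_min (hP.1 j) (by linarith [hsI j]), fun j => ?_⟩,
    ⟨hPJ, fun Q hQ => sum_sq_lt_sq hd fun j => ?_⟩, ?_⟩
  · change min (P j) (I.upper j - s) + s ≤ I.upper j
    linarith [min_le_right (P j) (I.upper j - s)]
  · refine le_trans ?_ hsd.le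
    rw [Real.dist_eq, abs_le]
    constructor <;> linarith [hedge j, hPJ.1 j, hPJ.2 j, hQ.1 j, hQ.2 j]
  · simp only [brickRegularity, brickVolume, hedge, Finset.prod_const, Finset.card_univ,
      Fintype.card_fin]
    rcases Nat.eq_zero_or_pos n with rfl | hn
    · simp
    · have : Nonempty (Fin n) := ⟨⟨0, hn⟩⟩
      rw [ciSup_const, div_self (pow_pos hs n).ne']

theorem HasBrickDerivAt.unique {h : Box (Fin n) → 𝕜} {P : Fin n → ℝ} (hP : P ∈ Box.Icc I)
    {D D' : 𝕜} (hD : HasBrickDerivAt h I D P) (hD' : HasBrickDerivAt h I D' P) : D = D' := by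
  refine eq_of_forall_dist_le fun ε hε => ?_
  obtain ⟨d, hd, H⟩ := hD (ε / 2) (half_pos hε) 1 one_pos
  obtain ⟨d', hd', H'⟩ := hD' (ε / 2) (half_pos hε) 1 one_pos
  obtain ⟨J, hJ, hc, hr⟩ := exists_regular_box hP (lt_min hd hd')
  have h0 : 0 ≤ min d d' := (lt_min hd hd').le
  have h1 := H J hJ ⟨hc.1, fun Q hQ => (hc.2 Q hQ).trans_le
    (pow_le_pow_left₀ h0 (min_le_left _ _) 2)⟩ hr
  have h2 := H' J hJ ⟨hc.1, fun Q hQ => (hc.2 Q hQ).trans_le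
    (pow_le_pow_left₀ h0 (min_le_right _ _) 2)⟩ hr
  rw [← dist_eq_norm] at h1 h2
  linarith [dist_triangle_left D D' (h J / (brickVolume J : 𝕜))]

theorem volume_closedBall_three_mul_le {C : NNReal} (hC : (3 : ℝ) ^ n ≤ C) (P : Fin n → ℝ) {r : ℝ}
    (hr : 0 ≤ r) :
    volume (Metric.closedBall P (3 * r)) ≤ C * volume (Metric.closedBall P r) := by
  rw [Real.volume_pi_closedBall _ (by positivity), Real.volume_pi_closedBall _ hr,
    ← ENNReal.ofReal_coe_nnreal, ← ENNReal.ofReal_mul C.coe_nonneg, Fintype.card_fin]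
  refine ENNReal.ofReal_le_ofReal ?_
  rw [mul_left_comm, mul_pow]
  gcongr

/-- A brick of regularity at least `α` fills a fixed proportion of a ball three times its size. -/
theorem volume_closedBall_le_of_le_regularity {α : ℝ} (hα : 0 < α) {C : NNReal}
    (hC : (6 : ℝ) ^ n / α ≤ C) {J : Box (Fin n)} (hJ : α ≤ brickRegularity J) (P : Fin n → ℝ) :
    volume (Metric.closedBall P (3 * ⨆ j, (J.upper j - J.lower j))) ≤
      C * volume (Box.Icc J) := by
  have hd := iSup_edge_nonneg J
  rw [brickRegularity] at hJ
  set d := ⨆ j, (J.upper j - J.lower j)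
  -- If `d ^ n` were 0, division by zero would make the regularity 0, below `α`.
  have hdn : 0 < d ^ n := by
    refine (pow_nonneg hd n).lt_of_ne fun h0 => ?_
    rw [← h0, div_zero] at hJ
    linarith
  rw [le_div_iff₀ hdn] at hJ
  rw [Real.volume_pi_closedBall _ (by positivity), volume_Icc_box,
    ← ENNReal.ofReal_coe_nnreal, ← ENNReal.ofReal_mul C.coe_nonneg, Fintype.card_fin]
  refine ENNReal.ofReal_le_ofReal ?_
  calc (2 * (3 * d)) ^ n = 6 ^ n / α * (α * d ^ n) := by
        rw [← mul_assoc, mul_pow]; norm_num; field_simp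
    _ ≤ C * brickVolume J := by gcongr

/-- Closed bricks of regularity at least `1 / (m + 1)` belong to a Vitali family with constant `C
m`, along which averages of `g`, extended by 0, converge almost everywhere. Countably many `m`
suffice for all `α`, so one null set serves them all. -/
theorem ae_hasBrickDerivAt {h : Box (Fin n) → 𝕜} {g : (Fin n → ℝ) → 𝕜}
    (hg : IntegrableOn g (I : Set (Fin n → ℝ)))
    (hgJ : ∀ J ≤ I, ∫ x in (J : Set (Fin n → ℝ)), g x = h J) :
    ∀ᵐ P ∂volume.restrict (I : Set (Fin n → ℝ)), HasBrickDerivAt h I (g P) P := by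
  have hG : MeasureTheory.Integrable ((I : Set (Fin n → ℝ)).indicator g) :=
    (integrable_indicator_iff I.measurableSet_coe).2 hg
  -- A sup-norm ball of radius `3 * d` is a cube of side `6 * d`; a brick of longest edge `d` and
  -- regularity at least `1 / (m + 1)` has volume at least `d ^ n / (m + 1)`.
  let C : ℕ → NNReal := fun m => 6 ^ n * (m + 1)
  have hC3 : ∀ m, (3 : ℝ) ^ n ≤ C m := fun m => by
    have h1 : (3 : ℝ) ^ n ≤ 6 ^ n := pow_le_pow_left₀ (by norm_num) (by norm_num) n
    have h2 : (1 : ℝ) ≤ m + 1 := by linarith [(Nat.cast_nonneg m : (0 : ℝ) ≤ m)]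
    push_cast [C]
    nlinarith [pow_pos (by norm_num : (0 : ℝ) < 6) n]
  let v : ℕ → VitaliFamily (volume : Measure (Fin n → ℝ)) := fun m =>
    Vitali.vitaliFamily volume (C m) fun P => Eventually.frequently <| by
      filter_upwards [self_mem_nhdsWithin] with r hr
      exact volume_closedBall_three_mul_le (hC3 m) P (le_of_lt hr)
  have hae : ∀ᵐ P, ∀ m, Tendsto (fun a => ⨍ y in a, (I : Set (Fin n → ℝ)).indicator g y)
      ((v m).filterAt P) (𝓝 ((I : Set (Fin n → ℝ)).indicator g P)) :=
    ae_all_iff.2 fun m => (v m).ae_tendsto_average hG.locallyIntegrable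
  rw [ae_restrict_iff' I.measurableSet_coe]
  filter_upwards [hae] with P hP hPI ε hε α hα
  rw [indicator_of_mem hPI] at hP
  obtain ⟨m, hm⟩ := exists_nat_one_div_lt hα
  obtain ⟨d, hd, H⟩ := ((v m).eventually_filterAt_iff).1
    ((hP m).eventually (Metric.ball_mem_nhds _ hε))
  refine ⟨d, hd, fun J hJ hc hr => ?_⟩
  have hmem : Box.Icc J ∈ (v m).setsAt P := by
    refine ⟨isClosed_Icc, ?_, _, Icc_subset_closedBall_iSup_edge hc.1,
      volume_closedBall_le_of_le_regularity (α := 1 / ((m : ℝ) + 1)) (by positivity) ?_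
        (hm.le.trans hr) P⟩
    · refine Nonempty.mono (interior_maximal (Box.Ioo_subset_Icc J) (isOpen_box_Ioo J))
        ⟨fun j => (J.lower j + J.upper j) / 2, fun j _ => ⟨?_, ?_⟩⟩ <;>
      linarith [J.lower_lt_upper j]
    · push_cast [C]; rw [div_div_eq_mul_div, div_one]
  have havg : ⨍ y in Box.Icc J, (I : Set (Fin n → ℝ)).indicator g y =
      h J / (brickVolume J : 𝕜) := by
    rw [setAverage_eq, measureReal_def, volume_Icc_box,
      ENNReal.toReal_ofReal (brickVolume_pos J).le,
      ← setIntegral_congr_set (Box.coe_ae_eq_Icc J), setIntegral_indicator I.measurableSet_coe,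
      inter_eq_left.2 (Box.coe_subset_coe.2 hJ), hgJ J hJ, RCLike.real_smul_eq_coe_mul,
      RCLike.ofReal_inv, div_eq_inv_mul]
  rw [← havg, ← dist_eq_norm]
  exact H _ hmem (hc.Icc_subset_closedBall hd)

end Derivative

/-! ### The theorem. -/

theorem mainTheorem7 {n : ℕ} {𝕜 : Type*} [RCLike 𝕜] (I : BoxIntegral.Box (Fin n))
    (h : BoxIntegral.BoxAdditiveMap (Fin n) 𝕜 (I : WithTop (BoxIntegral.Box (Fin n))))
    (hac : BrickAbsolutelyContinuous (fun J => h J) I) :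
    brickVariation brickVolume I
        {P | P ∈ BoxIntegral.Box.Icc I ∧ ¬ ∃ D : 𝕜, HasBrickDerivAt (fun J => h J) I D P} = 0 ∧
      ∀ f : (Fin n → ℝ) → 𝕜,
        (∀ P ∈ BoxIntegral.Box.Icc I, (∃ D : 𝕜, HasBrickDerivAt (fun J => h J) I D P) →
          HasBrickDerivAt (fun J => h J) I (f P) P) →
        ∀ J ≤ I,
          BoxIntegral.HasIntegral J BoxIntegral.IntegrationParams.Henstock f
            BoxIntegral.BoxAdditiveMap.volume (h J) ∧
          BoxIntegral.Integrable J BoxIntegral.IntegrationParams.Henstock (fun P => ‖f P‖)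
            BoxIntegral.BoxAdditiveMap.volume := by
  obtain ⟨g, hg, hgJ⟩ := hac.exists_setIntegral_eq
  have hD := ae_hasBrickDerivAt hg hgJ
  refine ⟨le_antisymm ((brickVariation_brickVolume_le I _).trans_eq ?_) zero_le, ?_⟩
  · rw [Measure.restrict_congr_set (BoxIntegral.Box.coe_ae_eq_Icc I),
      ae_restrict_iff' (BoxIntegral.Box.measurableSet_Icc I)] at hD
    rw [ae_iff] at hD
    refine measure_mono_null (fun P hP => ?_) hD
    exact fun hP' => hP.2 ⟨g P, hP' hP.1⟩
  · intro f hf J hJ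
    -- Both `g P` and `f P` are derivatives at almost every `P`, so they agree by uniqueness.
    have hfg : g =ᵐ[volume.restrict (I : Set (Fin n → ℝ))] f := by
      filter_upwards [hD, ae_restrict_mem I.measurableSet_coe] with P hP hPI
      have hPI' := BoxIntegral.Box.coe_subset_Icc hPI
      exact hP.unique hPI' (hf P hPI' ⟨_, hP⟩)
    have hJI := BoxIntegral.Box.coe_subset_coe.2 hJ
    have hfJ : IntegrableOn f (J : Set (Fin n → ℝ)) :=
      IntegrableOn.mono_set (hg.congr hfg) hJI
    -- The `rfl` checks that Henstock integration allows gauges depending on the point, which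
    -- integrating arbitrary Lebesgue integrable functions requires.
    refine ⟨?_, _, IntegrableOn.hasBoxIntegral (f := fun P => ‖f P‖) hfJ.norm _ rfl⟩
    rw [← hgJ J hJ, integral_congr_ae (ae_restrict_of_ae_restrict_of_subset hJI hfg)]
    exact hfJ.hasBoxIntegral _ rfl
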